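/- **Model.** Let $d,m\ge 1$. A $T$-query algorithm with an $m$-qubit proof for $d$-dimensional unitaries acts on a control qubit, a $d$-dimensional query register, an $m$-qubit proof register and an ancilla register of arbitrary finite dimension. The proof register starts in a unit vector $|\psi\rangle\in(\mathbb C^2)^{\otimes m}$ (the proof), and the other registers start in fixed standard basis states. The algorithm applies fixed unitaries $A_0,A_1,\dots,A_T$ that do not depend on the oracle $U$, and between $A_{j-1}$ and $A_j$ (for $1\le j\le T$) it makes one controlled query, to $U$ or to $U^*$ (which of the two is fixed in advance for each $j$). It then measures in the standard basis and accepts if the outcome lies in a fixed set. **Problem.** For an integer $t\ge 1$ and a real $\epsilon>0$, the $(t,\epsilon)$-Recurrence Time problem for $d$-dimensional unitaries has as *yes* instances the unitaries $U\in \mathrm U(d)$ with $U^t=I$, and as *no* instances those with $\|U^t-I\|\ge\epsilon$ in the spectral norm. An algorithm with an $m$-qubit proof solves it if for every *yes* instance $U$ there is a proof with which it accepts with probability at least $2/3$, and for every *no* instance $U$ it accepts with probability at most $1/3$ whatever the proof. **Theorem** (QMA lower bound for the Recurrence Time problem). There are universal constants $c_1,c_2>0$ such that the following holds for all integers $d,t,m\ge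 1$, $T\ge 0$ and all real $0<\epsilon\le\frac1{2\pi}$. If some $T$-query algorithm with an $m$-qubit proof solves the $(t,\epsilon)$-Recurrence Time problem for $d$-dimensional unitaries, then either $$m\ \ge\ c_1\,d\qquad\text{or}\qquad T\ \ge\ c_2\max\Big(\sqrt{\tfrac dm},\ \tfrac tm,\ \tfrac1\epsilon\Big).$$ -/

import Mathlib

open scoped Matrix.Norms.L2Operator

noncomputable section

/-- Basis labels `(b, i, x, w)` of the registers of a query algorithm: a control qubit `b`,
a `d`-dimensional query register `i`, an `m`-qubit proof register `x`, and an
`r`-dimensional ancilla register `w`. -/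
abbrev Reg (d m r : ℕ) : Type := Fin 2 × Fin d × (Fin m → Fin 2) × Fin r

/-- The state space of the registers. -/
abbrev RegState (d m r : ℕ) : Type := EuclideanSpace ℂ (Reg d m r)

/-- The controlled application of a `d × d` matrix `U` to the query register: the part of the
state with control bit `1` is mapped by `U`, the part with control bit `0` is unchanged. -/
def controlled {d m r : ℕ} (U : Matrix (Fin d) (Fin d) ℂ) (φ : RegState d m r) :
    RegState d m r :=
  WithLp.toLp 2 fun (b, i, x, w) =>
    if b = 1 then ∑ j, U i j * φ (b, j, x, w) else φ (b, i, x, w)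

/-- A quantum query algorithm for `d`-dimensional oracles that receives an `m`-qubit proof.
It applies the fixed unitary `first`, and then, for each entry `(inv, A)` of the list `steps` in
turn, makes one controlled query (to `U` if `inv = false`, to `U*` if `inv = true`) and applies
the fixed unitary `A`. Finally all registers are measured in the standard basis, and the algorithm
accepts if the outcome lies in `accept`. The query register and the ancilla register start in
the basis states `queryStart` and `ancillaStart`, the control qubit in `|0⟩`. -/
structure QueryAlgorithm (d m : ℕ) where
  ancillaDim : ℕ
  queryStart : Fin d
  ancillaStart : Fin ancillaDim
  first : RegState d m ancillaDim ≃ₗᵢ[ℂ] RegState d m ancillaDim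
  steps : List (Bool × (RegState d m ancillaDim ≃ₗᵢ[ℂ] RegState d m ancillaDim))
  accept : Finset (Reg d m ancillaDim)

namespace QueryAlgorithm

variable {d m : ℕ}

/-- The number of queries made by the algorithm. -/
def numQueries (A : QueryAlgorithm d m) : ℕ := A.steps.length

/-- The initial state `|0⟩ ⊗ |queryStart⟩ ⊗ |ψ⟩ ⊗ |ancillaStart⟩`. -/
def initialState (A : QueryAlgorithm d m) (ψ : EuclideanSpace ℂ (Fin m → Fin 2)) :
    RegState d m A.ancillaDim :=
  WithLp.toLp 2 fun (b, i, x, w) =>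
    if b = 0 ∧ i = A.queryStart ∧ w = A.ancillaStart then ψ x else 0

/-- One step: a controlled query to `U` or to `U*`, followed by a fixed unitary. -/
def step {r : ℕ} (U : Matrix.unitaryGroup (Fin d) ℂ) (φ : RegState d m r)
    (s : Bool × (RegState d m r ≃ₗᵢ[ℂ] RegState d m r)) : RegState d m r :=
  s.2 (controlled (if s.1 then (star U : Matrix.unitaryGroup (Fin d) ℂ).1 else U.1) φ)

/-- The state before the final measurement, on oracle `U` and proof `ψ`. -/
def finalState (A : QueryAlgorithm d m) (U : Matrix.unitaryGroup (Fin d) ℂ)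
    (ψ : EuclideanSpace ℂ (Fin m → Fin 2)) : RegState d m A.ancillaDim :=
  A.steps.foldl (step U) (A.first (A.initialState ψ))

/-- The probability that the algorithm accepts, on oracle `U` and proof `ψ`. -/
def acceptProb (A : QueryAlgorithm d m) (U : Matrix.unitaryGroup (Fin d) ℂ)
    (ψ : EuclideanSpace ℂ (Fin m → Fin 2)) : ℝ :=
  ∑ k ∈ A.accept, ‖A.finalState U ψ k‖ ^ 2

/-- The algorithm is a `QMA` tester for the property with the given yes and no instances. -/
def IsQMATester (A : QueryAlgorithm d m) (yes no : Set (Matrix.unitaryGroup (Fin d) ℂ)) : Prop :=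
  (∀ U ∈ yes, ∃ ψ : EuclideanSpace ℂ (Fin m → Fin 2), ‖ψ‖ = 1 ∧ 2 / 3 ≤ A.acceptProb U ψ) ∧
  (∀ U ∈ no, ∀ ψ : EuclideanSpace ℂ (Fin m → Fin 2), ‖ψ‖ = 1 → A.acceptProb U ψ ≤ 1 / 3)

end QueryAlgorithm

/-- Yes instances of the `(t, ε)`-Recurrence Time problem in dimension `d`: `U ^ t = I`. -/
def recurrenceYes (d t : ℕ) : Set (Matrix.unitaryGroup (Fin d) ℂ) :=
  {U | U ^ t = 1}

/-- No instances of the `(t, ε)`-Recurrence Time problem in dimension `d`: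
`‖U ^ t - I‖ ≥ ε` in the spectral norm. -/
def recurrenceNo (d t : ℕ) (ε : ℝ) : Set (Matrix.unitaryGroup (Fin d) ℂ) :=
  {U | ε ≤ ‖(U : Matrix (Fin d) (Fin d) ℂ) ^ t - 1‖}

end

open QueryAlgorithm

/-! The identity is a yes instance; fix a proof `ψ` accepted on it. Putting a phase `ω` with angle
`2ε/t` at one of the `d` diagonal positions `v` gives `d` no instances, and soundness applied to
this same `ψ` forces each final state to be at distance at least `1/6` from the one for the
identity. In a hybrid argument, a query disturbs the identity-run state only through its amplitude
at `v`, so by Cauchy–Schwarz the disturbances over all `v` sum to at most `‖ω - 1‖ √d` per query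
(`sum_norm_foldl_step_sub_le`). Hence `d/6 ≤ T · (2ε/t) · √d`, that is, `T ≥ √d · t / (12 ε)`,
whatever the proof length. This product dominates each term of the maximum. -/

/-- The diagonal entries of the phase oracle: `ω` at position `v`, and `1` elsewhere. -/
def phaseEntry {d : ℕ} (ω : ℂ) (v : Fin d) : Fin d → ℂ := fun i => if i = v then ω else 1

theorem norm_phaseEntry {d : ℕ} {ω : ℂ} (hω : ‖ω‖ = 1) (v i : Fin d) :
    ‖phaseEntry ω v i‖ = 1 := by
  unfold phaseEntry; split_ifs <;> simp [hω]

theorem star_phaseEntry {d : ℕ} (ω : ℂ) (v : Fin d) :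
    star (phaseEntry ω v) = phaseEntry (star ω) v := by
  ext i; simp only [phaseEntry, Pi.star_apply]; split_ifs <;> simp

/-- The unitary that multiplies the basis vector `v` by the phase `ω` and fixes the others. -/
def phaseOracle {d : ℕ} (ω : ℂ) (hω : ‖ω‖ = 1) (v : Fin d) : Matrix.unitaryGroup (Fin d) ℂ :=
  ⟨Matrix.diagonal (phaseEntry ω v), by
    rw [Matrix.mem_unitaryGroup_iff, Matrix.star_eq_conjTranspose, Matrix.diagonal_conjTranspose,
      Matrix.diagonal_mul_diagonal, ← Matrix.diagonal_one]
    congr 1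
    ext i
    have h := norm_phaseEntry hω v i
    simp only [Pi.star_apply, RCLike.star_def, Complex.mul_conj, Complex.normSq_eq_norm_sq, h]
    simp⟩

/-- A controlled diagonal query multiplies every amplitude by a scalar. -/
theorem controlled_diagonal_apply {d m r : ℕ} (u : Fin d → ℂ) (φ : RegState d m r)
    (k : Reg d m r) :
    controlled (Matrix.diagonal u) φ k = (if k.1 = 1 then u k.2.1 else 1) * φ k := by
  obtain ⟨b, i, x, w⟩ := k
  simp only [controlled]
  split_ifs <;> simp [Matrix.diagonal_apply]

theorem controlled_one {d m r : ℕ} (φ : RegState d m r) :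
    controlled (1 : Matrix (Fin d) (Fin d) ℂ) φ = φ := by
  ext k
  rw [← Matrix.diagonal_one, controlled_diagonal_apply]
  simp

theorem norm_controlled_phase_sub {d m r : ℕ} {ω : ℂ} (hω : ‖ω‖ = 1) (v : Fin d)
    (φ ψ : RegState d m r) :
    ‖controlled (Matrix.diagonal (phaseEntry ω v)) φ
      - controlled (Matrix.diagonal (phaseEntry ω v)) ψ‖ = ‖φ - ψ‖ := by
  rw [EuclideanSpace.norm_eq, EuclideanSpace.norm_eq]
  congr 1
  refine Finset.sum_congr rfl fun k _ => ?_
  rw [PiLp.sub_apply, controlled_diagonal_apply, controlled_diagonal_apply, ← mul_sub, norm_mul,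
    PiLp.sub_apply]
  split_ifs <;> simp [norm_phaseEntry hω]

theorem norm_sq_controlled_phase_sub_self {d m r : ℕ} (ω : ℂ) (v : Fin d)
    (φ : RegState d m r) :
    ‖controlled (Matrix.diagonal (phaseEntry ω v)) φ - φ‖ ^ 2 =
      ∑ k, if k.1 = 1 ∧ k.2.1 = v then ‖ω - 1‖ ^ 2 * ‖φ k‖ ^ 2 else 0 := by
  rw [EuclideanSpace.norm_sq_eq]
  refine Finset.sum_congr rfl fun k _ => ?_
  rw [PiLp.sub_apply, controlled_diagonal_apply, ← sub_one_mul, norm_mul, mul_pow]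
  by_cases h1 : k.1 = 1 <;> by_cases h2 : k.2.1 = v <;> simp [h1, h2, phaseEntry]

/-- Over all positions of the phase, the squared disturbances of a state by one query sum to at
most `‖ω - 1‖ ^ 2 * ‖φ‖ ^ 2`. -/
theorem sum_norm_sq_controlled_phase_sub_self_le {d m r : ℕ} (ω : ℂ) (φ : RegState d m r) :
    ∑ v, ‖controlled (Matrix.diagonal (phaseEntry ω v)) φ - φ‖ ^ 2 ≤ ‖ω - 1‖ ^ 2 * ‖φ‖ ^ 2 := by
  simp_rw [norm_sq_controlled_phase_sub_self]
  rw [Finset.sum_comm, EuclideanSpace.norm_sq_eq, Finset.mul_sum]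
  refine Finset.sum_le_sum fun k _ => ?_
  -- A basis label is affected by a single position `v`, namely its own query index.
  by_cases h1 : k.1 = 1
  · simp [h1]
  · simp only [h1, false_and, if_false, Finset.sum_const_zero]
    positivity

/-- Cauchy–Schwarz over the `d` positions costs only `√d`, because the squared disturbances share
one unit of mass. -/
theorem sum_norm_controlled_phase_sub_self_le {d m r : ℕ} (ω : ℂ) (φ : RegState d m r) :
    ∑ v, ‖controlled (Matrix.diagonal (phaseEntry ω v)) φ - φ‖ ≤
      ‖ω - 1‖ * Real.sqrt d * ‖φ‖ := by
  refine le_of_sq_le_sq ?_ (by positivity)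
  calc _ ≤ (d : ℝ) * ∑ v, ‖controlled (Matrix.diagonal (phaseEntry ω v)) φ - φ‖ ^ 2 := by
        simpa using sq_sum_le_card_mul_sum_sq (s := (Finset.univ : Finset (Fin d)))
          (f := fun v => ‖controlled (Matrix.diagonal (phaseEntry ω v)) φ - φ‖)
    _ ≤ d * (‖ω - 1‖ ^ 2 * ‖φ‖ ^ 2) := by
        gcongr; exact sum_norm_sq_controlled_phase_sub_self_le ω φ
    _ = _ := by rw [mul_pow, mul_pow, Real.sq_sqrt (Nat.cast_nonneg d)]; ring

theorem step_one {d m r : ℕ} (φ : RegState d m r)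
    (s : Bool × (RegState d m r ≃ₗᵢ[ℂ] RegState d m r)) : step 1 φ s = s.2 φ := by
  have h : (if s.1 then (star (1 : Matrix.unitaryGroup (Fin d) ℂ)).1
      else (1 : Matrix.unitaryGroup (Fin d) ℂ).1) = 1 := by split_ifs <;> simp
  rw [step, h, controlled_one]

/-- A query to the phase oracle, in either direction, is a query to a diagonal phase whose
distance from `1` is `‖ω - 1‖`. -/
theorem exists_step_phaseOracle {d m r : ℕ} {ω : ℂ} (hω : ‖ω‖ = 1)
    (s : Bool × (RegState d m r ≃ₗᵢ[ℂ] RegState d m r)) :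
    ∃ η : ℂ, ‖η‖ = 1 ∧ ‖η - 1‖ = ‖ω - 1‖ ∧ ∀ (v : Fin d) (φ : RegState d m r),
      step (phaseOracle ω hω v) φ s =
        s.2 (controlled (Matrix.diagonal (phaseEntry η v)) φ) := by
  obtain ⟨b, A⟩ := s
  cases b
  · exact ⟨ω, hω, rfl, fun v φ => rfl⟩
  · refine ⟨star ω, by simpa using hω, ?_, fun v φ => ?_⟩
    · rw [← norm_star (ω - 1), star_sub, star_one]
    · have h : (star (phaseOracle ω hω v) : Matrix.unitaryGroup (Fin d) ℂ).1 =
          Matrix.diagonal (phaseEntry (star ω) v) := by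
        rw [← star_phaseEntry, ← Matrix.diagonal_conjTranspose]; rfl
      simp only [step, if_true, h]

/-! ### Hybrid argument -/

/-- The hybrid argument: the states produced with the phase oracles stay close, on average over
the position of the phase, to the state produced with the identity oracle. -/
theorem sum_norm_foldl_step_sub_le {d m r : ℕ} {ω : ℂ} (hω : ‖ω‖ = 1)
    (l : List (Bool × (RegState d m r ≃ₗᵢ[ℂ] RegState d m r)))
    (φ : RegState d m r) (χ : Fin d → RegState d m r) :
    ∑ v, ‖l.foldl (step (phaseOracle ω hω v)) (χ v) - l.foldl (step 1) φ‖ ≤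
      ∑ v, ‖χ v - φ‖ + l.length * (‖ω - 1‖ * Real.sqrt d * ‖φ‖) := by
  -- The starting states may depend on `v`, since the runs have already diverged after one query.
  induction l generalizing φ χ with
  | nil => simp
  | cons s l ih =>
    obtain ⟨η, hη, hdist, hstep⟩ := exists_step_phaseOracle (d := d) hω s
    simp only [List.foldl_cons]
    refine (ih (step 1 φ s) fun v => step (phaseOracle ω hω v) (χ v) s).trans ?_
    have key : ∑ v, ‖step (phaseOracle ω hω v) (χ v) s - step 1 φ s‖ ≤
        ∑ v, ‖χ v - φ‖ + ‖ω - 1‖ * Real.sqrt d * ‖φ‖ := by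
      calc _ ≤ ∑ v, (‖χ v - φ‖ +
              ‖controlled (Matrix.diagonal (phaseEntry η v)) φ - φ‖) := by
            refine Finset.sum_le_sum fun v _ => ?_
            -- Compare through the phase query applied to `φ`: that query is an isometry, so the old
            -- error is carried over unchanged and only the disturbance of `φ` is added.
            rw [hstep, step_one, ← map_sub, LinearIsometryEquiv.norm_map,
              ← norm_controlled_phase_sub hη v (χ v) φ]
            exact norm_sub_le_norm_sub_add_norm_sub _ _ _
        _ ≤ _ := by
            rw [Finset.sum_add_distrib, ← hdist]
            gcongr
            exact sum_norm_controlled_phase_sub_self_le η φ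
    rw [step_one, LinearIsometryEquiv.norm_map]
    rw [step_one] at key
    push_cast [List.length_cons]
    linarith

theorem norm_step_phaseOracle {d m r : ℕ} {ω : ℂ} (hω : ‖ω‖ = 1) (v : Fin d)
    (φ : RegState d m r) (s : Bool × (RegState d m r ≃ₗᵢ[ℂ] RegState d m r)) :
    ‖step (phaseOracle ω hω v) φ s‖ = ‖φ‖ := by
  obtain ⟨η, hη, -, hstep⟩ := exists_step_phaseOracle (d := d) hω s
  have h0 : controlled (Matrix.diagonal (phaseEntry η v)) (0 : RegState d m r) = 0 := by
    ext k; rw [controlled_diagonal_apply]; simp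
  have := norm_controlled_phase_sub hη v φ 0
  rw [h0, sub_zero, sub_zero] at this
  rw [hstep, LinearIsometryEquiv.norm_map, this]

namespace QueryAlgorithm

variable {d m : ℕ}

theorem norm_initialState (A : QueryAlgorithm d m) (ψ : EuclideanSpace ℂ (Fin m → Fin 2)) :
    ‖A.initialState ψ‖ = ‖ψ‖ := by
  rw [EuclideanSpace.norm_eq, EuclideanSpace.norm_eq]
  congr 1
  simp only [initialState, Fintype.sum_prod_type]
  rw [Finset.sum_eq_single 0 (by intro b _ hb; simp [hb]) (by simp),
    Finset.sum_eq_single A.queryStart (by intro i _ hi; simp [hi]) (by simp)]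
  refine Finset.sum_congr rfl fun x _ => ?_
  rw [Finset.sum_eq_single A.ancillaStart (by intro w _ hw; simp [hw]) (by simp)]
  simp

theorem norm_finalState_one (A : QueryAlgorithm d m) (ψ : EuclideanSpace ℂ (Fin m → Fin 2)) :
    ‖A.finalState 1 ψ‖ = ‖ψ‖ := by
  have h : ∀ (l : List (Bool × (RegState d m A.ancillaDim ≃ₗᵢ[ℂ] RegState d m A.ancillaDim))) φ,
      ‖l.foldl (step 1) φ‖ = ‖φ‖ := by
    intro l
    induction l with
    | nil => simp
    | cons s l ih => intro φ; rw [List.foldl_cons, ih, step_one, LinearIsometryEquiv.norm_map]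
  rw [finalState, h, LinearIsometryEquiv.norm_map, norm_initialState]

theorem norm_finalState_phaseOracle (A : QueryAlgorithm d m) {ω : ℂ} (hω : ‖ω‖ = 1) (v : Fin d)
    (ψ : EuclideanSpace ℂ (Fin m → Fin 2)) :
    ‖A.finalState (phaseOracle ω hω v) ψ‖ = ‖ψ‖ := by
  have h : ∀ (l : List (Bool × (RegState d m A.ancillaDim ≃ₗᵢ[ℂ] RegState d m A.ancillaDim))) φ,
      ‖l.foldl (step (phaseOracle ω hω v)) φ‖ = ‖φ‖ := by
    intro l
    induction l with
    | nil => simp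
    | cons s l ih => intro φ; rw [List.foldl_cons, ih, norm_step_phaseOracle]
  rw [finalState, h, LinearIsometryEquiv.norm_map, norm_initialState]

end QueryAlgorithm

/-! ### Measurement gap and hard instances -/

/-- The measurement statistics of two unit vectors differ by at most twice their distance. -/
theorem sum_norm_sq_sub_le {ι : Type*} [Fintype ι] (s : Finset ι) (x y : EuclideanSpace ℂ ι)
    (hx : ‖x‖ = 1) (hy : ‖y‖ = 1) :
    ∑ k ∈ s, ‖x k‖ ^ 2 - ∑ k ∈ s, ‖y k‖ ^ 2 ≤ 2 * ‖y - x‖ := by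
  have h1 : ∑ k ∈ s, ‖x k‖ ^ 2 - ∑ k ∈ s, ‖y k‖ ^ 2 ≤
      ∑ k, ‖(y - x) k‖ * (‖x k‖ + ‖y k‖) := by
    rw [← Finset.sum_sub_distrib]
    refine (Finset.sum_le_sum fun k _ => ?_).trans
      (Finset.sum_le_univ_sum_of_nonneg fun k => by positivity)
    have h := norm_sub_norm_le (x k) (y k)
    rw [norm_sub_rev, ← PiLp.sub_apply] at h
    have h' : 0 ≤ ‖x k‖ + ‖y k‖ := by positivity
    nlinarith
  have cs : ∀ z w : EuclideanSpace ℂ ι, ∑ k, ‖z k‖ * ‖w k‖ ≤ ‖z‖ * ‖w‖ := by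
    intro z w
    rw [EuclideanSpace.norm_eq, EuclideanSpace.norm_eq]
    exact Real.sum_mul_le_sqrt_mul_sqrt _ _ _
  have h2 := cs (y - x) x
  have h3 := cs (y - x) y
  rw [hx] at h2
  rw [hy] at h3
  simp only [mul_add, Finset.sum_add_distrib] at h1
  linarith

/-- A phase oracle is a *no* instance if the `t`-th power of its phase is far from `1`. -/
theorem phaseOracle_mem_recurrenceNo {d t : ℕ} {ε : ℝ} {ω : ℂ} (hω : ‖ω‖ = 1) (v : Fin d)
    (h : ε ≤ ‖ω ^ t - 1‖) : phaseOracle ω hω v ∈ recurrenceNo d t ε := by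
  have hU : (phaseOracle ω hω v : Matrix (Fin d) (Fin d) ℂ) ^ t - 1 =
      Matrix.diagonal (phaseEntry ω v ^ t - 1) := by
    change Matrix.diagonal (phaseEntry ω v) ^ t - 1 = _
    rw [Matrix.diagonal_pow, ← Matrix.diagonal_one, Matrix.diagonal_sub]
    rfl
  have hv : (phaseEntry ω v ^ t - 1) v = ω ^ t - 1 := by simp [phaseEntry]
  rw [recurrenceNo, Set.mem_ofPred_eq, hU, Matrix.l2_opNorm_diagonal]
  refine h.trans ?_
  rw [← hv]
  exact norm_le_pi_norm (phaseEntry ω v ^ t - 1) v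

/-- At angle `2ε/t` the `t`-th power has angle `2ε`, whose chord is `2 sin ε ≥ ε`. -/
theorem exists_phase {t : ℕ} (ht : 1 ≤ t) {ε : ℝ} (hε : 0 < ε) (hε1 : ε ≤ 1) :
    ∃ ω : ℂ, ‖ω‖ = 1 ∧ ‖ω - 1‖ ≤ 2 * ε / t ∧ ε ≤ ‖ω ^ t - 1‖ := by
  have ht' : (0 : ℝ) < t := by exact_mod_cast ht
  refine ⟨Complex.exp (Complex.I * (2 * ε / t : ℝ)), ?_, ?_, ?_⟩
  · rw [mul_comm, Complex.norm_exp_ofReal_mul_I]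
  · refine (Real.norm_exp_I_mul_ofReal_sub_one_le).trans (le_of_eq ?_)
    rw [Real.norm_of_nonneg (by positivity)]
  · have hpow : Complex.exp (Complex.I * (2 * ε / t : ℝ)) ^ t =
        Complex.exp (Complex.I * (2 * ε : ℝ)) := by
      have htc : (t : ℂ) ≠ 0 := by exact_mod_cast ht'.ne'
      rw [← Complex.exp_nat_mul]
      congr 1
      push_cast
      field_simp
    rw [hpow, Complex.norm_exp_I_mul_ofReal_sub_one, mul_div_cancel_left₀ _ two_ne_zero]
    -- Jordan's inequality with `π ≤ 4` gives `sin ε ≥ ε/2`.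
    have h1 := Real.mul_le_sin hε.le (by linarith [Real.pi_gt_three])
    have h2 : (1 : ℝ) / 2 ≤ 2 / Real.pi := by
      rw [div_le_div_iff₀ two_pos Real.pi_pos]; linarith [Real.pi_le_four]
    have h3 := mul_le_mul_of_nonneg_right h2 hε.le
    rw [Real.norm_of_nonneg (by linarith)]
    linarith

/-- The hybrid lower bound for the recurrence time problem. It holds for every proof length, since
a proof accepted on the identity oracle can be fixed in advance. -/
theorem QueryAlgorithm.IsQMATester.le_numQueries {d t m : ℕ} {ε : ℝ} (ht : 1 ≤ t) (hε : 0 < ε)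
    (hε1 : ε ≤ 1) {A : QueryAlgorithm d m}
    (hA : A.IsQMATester (recurrenceYes d t) (recurrenceNo d t ε)) :
    Real.sqrt d * t / ε ≤ 12 * A.numQueries := by
  obtain ⟨ω, hω, hclose, hfar⟩ := exists_phase ht hε hε1
  obtain ⟨ψ, hψ, hyes⟩ := hA.1 1 (by simp [recurrenceYes])
  -- Half of the acceptance gap `2/3 - 1/3`.
  have hsep : ∀ v, 1 / 6 ≤ ‖A.finalState (phaseOracle ω hω v) ψ - A.finalState 1 ψ‖ := by
    intro v
    have hno := hA.2 _ (phaseOracle_mem_recurrenceNo hω v hfar) ψ hψ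
    have h := sum_norm_sq_sub_le A.accept (A.finalState 1 ψ)
      (A.finalState (phaseOracle ω hω v) ψ) (by rw [A.norm_finalState_one, hψ])
      (by rw [A.norm_finalState_phaseOracle, hψ])
    unfold acceptProb at hyes hno
    linarith
  have hsum := Finset.sum_le_sum fun v (_ : v ∈ Finset.univ) => hsep v
  have hhyb := sum_norm_foldl_step_sub_le hω A.steps (A.first (A.initialState ψ))
    fun _ => A.first (A.initialState ψ)
  rw [LinearIsometryEquiv.norm_map, A.norm_initialState, hψ] at hhyb
  have hd : (d : ℝ) / 6 ≤ A.numQueries * (2 * ε / t * Real.sqrt d) := by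
    calc (d : ℝ) / 6 ≤ A.numQueries * (‖ω - 1‖ * Real.sqrt d) := by
          have := hsum.trans hhyb
          simp only [Finset.sum_const, Finset.card_univ, Fintype.card_fin, nsmul_eq_mul, sub_self,
            norm_zero, mul_zero, zero_add, mul_one] at this
          rw [numQueries]
          linarith
      _ ≤ _ := by gcongr
  have ht' : (0 : ℝ) < t := by exact_mod_cast ht
  have hs : 0 < Real.sqrt d := Real.sqrt_pos.2 (by exact_mod_cast A.queryStart.pos)
  rw [← Real.mul_self_sqrt (Nat.cast_nonneg d)] at hd
  rw [div_le_iff₀ hε]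
  have h : Real.sqrt d / 6 ≤ A.numQueries * (2 * ε / t) := by
    refine le_of_mul_le_mul_right ?_ hs
    rw [Real.sqrt_mul_self hs.le] at hd
    linarith
  rw [← mul_div_assoc, div_le_div_iff₀ (by norm_num) ht'] at h
  linarith

theorem mainTheorem7 :
    ∃ c₁ : ℝ, 0 < c₁ ∧ ∃ c₂ : ℝ, 0 < c₂ ∧
      ∀ (d t m T : ℕ) (ε : ℝ), 1 ≤ t → 1 ≤ m → 0 < ε → ε ≤ 1 / (2 * Real.pi) →
        ∀ A : QueryAlgorithm d m, A.numQueries = T →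
          A.IsQMATester (recurrenceYes d t) (recurrenceNo d t ε) →
            c₁ * (d : ℝ) ≤ (m : ℝ) ∨
              c₂ * max (Real.sqrt ((d : ℝ) / (m : ℝ))) (max ((t : ℝ) / (m : ℝ)) (1 / ε)) ≤
                (T : ℝ) := by
  -- The second alternative always holds, so the value of `c₁` is immaterial.
  refine ⟨1, one_pos, 1 / 12, by norm_num, ?_⟩
  rintro d t m T ε ht hm hε hεpi A rfl hA
  right
  have hε1 : ε ≤ 1 := hεpi.trans (by
    rw [div_le_one (by positivity)]; linarith [Real.pi_gt_three])
  have hT := hA.le_numQueries ht hε hε1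
  have ht1 : (1 : ℝ) ≤ t := by exact_mod_cast ht
  have hm1 : (1 : ℝ) ≤ m := by exact_mod_cast hm
  have hs : 1 ≤ Real.sqrt d := Real.one_le_sqrt.2 (by exact_mod_cast A.queryStart.pos)
  have hi : 1 ≤ 1 / ε := by rwa [le_div_iff₀ hε, one_mul]
  rw [← mul_one_div] at hT
  have hst : 1 ≤ Real.sqrt d * t := one_le_mul_of_one_le_of_one_le hs ht1
  -- The factors `√d`, `t` and `1/ε` are all at least `1`, so their product dominates each of them.
  suffices max (Real.sqrt ((d : ℝ) / m)) (max ((t : ℝ) / m) (1 / ε)) ≤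
      Real.sqrt d * t * (1 / ε) by linarith
  refine max_le ?_ (max_le ?_ ?_)
  · calc Real.sqrt ((d : ℝ) / m) ≤ Real.sqrt d :=
          Real.sqrt_le_sqrt (div_le_self (Nat.cast_nonneg d) hm1)
      _ ≤ Real.sqrt d * t := le_mul_of_one_le_right (by positivity) ht1
      _ ≤ _ := le_mul_of_one_le_right (by positivity) hi
  · calc (t : ℝ) / m ≤ t := div_le_self (by positivity) hm1
      _ ≤ Real.sqrt d * t := le_mul_of_one_le_left (by positivity) hs
      _ ≤ _ := le_mul_of_one_le_right (by positivity) hi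
  · exact le_mul_of_one_le_left (by positivity) hst
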